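/- Let $\mathbb{F}_{p^n}$ be the finite field with $p^n$ elements, where $p=7$ and $n>1$ is an odd integer, and let $d=\frac{p^n+1}{8}+\frac{p^n-1}{2}$ (a positive integer). For a map $f:\mathbb{F}_{p^n}\to\mathbb{F}_{p^n}$, $a\in\mathbb{F}_{p^n}^*$ and $b\in\mathbb{F}_{p^n}$, let $N(a,b)$ be the number of solutions $x\in\mathbb{F}_{p^n}$ of $f(x+a)-f(x)=b$, and let $\Delta_f=\max_{a\in\mathbb{F}_{p^n}^*,\,b\in\mathbb{F}_{p^n}}N(a,b)$ be the differential uniformity of $f$; $f$ is called differentially $k$-uniform if $\Delta_f=k$. Then the power function $f(x)=x^d$ on $\mathbb{F}_{p^n}$ is differentially $4$-uniform, that is, $\Delta_f=4$. -/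

import Mathlib

/-- `N(a, b)`: the number of solutions `x` in the finite field `F` of `f (x + a) - f x = b`. -/
def differenceCount {F : Type*} [Field F] [Fintype F] [DecidableEq F]
    (f : F → F) (a b : F) : ℕ :=
  (Finset.univ.filter (fun x : F => f (x + a) - f x = b)).card

/-- The differential uniformity of `f`: the maximum of `N(a, b)` over all `a ≠ 0` and all `b`
(a maximum over a finite nonempty set, since `1 ≠ 0` in a field). -/
def differentialUniformity {F : Type*} [Field F] [Fintype F] [DecidableEq F]
    (f : F → F) : ℕ :=
  (Finset.univ.filter (fun ab : F × F => ab.1 ≠ 0)).sup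
    (fun ab => differenceCount f ab.1 ab.2)

/-- `f` is differentially `k`-uniform if its differential uniformity equals `k`. -/
def IsDifferentiallyUniform {F : Type*} [Field F] [Fintype F] [DecidableEq F]
    (k : ℕ) (f : F → F) : Prop :=
  differentialUniformity f = k

/-! Put `q = 7 ^ n`. As `n` is odd, `-1` is a nonsquare, `d` is even and `8 * d ≡ 2 mod q - 1`. So
`x ^ d` is the unique square `u` with `u ^ 4 = ±x`, and only this description of the map is used. By
homogeneity one may take `a = 1`.

Write `b = 2 * c`, `u = f x`, `v = f (x + 1)`, `s = u + c`, so that `u = s - c` and `v = s + c`. If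
the signs for `x` and `x + 1` agree (pure), then `v ^ 4 - u ^ 4 = ±1`, and since `8 = 1` one of `±s`
is a root of the cubic `r * c * (r ^ 2 + c ^ 2) = 1`: at most three solutions (`pureRoot_injOn`). If
they differ (mixed), then `s ^ 4 - s ^ 2 * c ^ 2 + c ^ 4 = ±4`; as a sum of two squares vanishes
only trivially, there is at most one such solution (`isMixed_unique`). The case `c = 0` is separate.
Hence the bound 4.

For equality, start from nonzero squares `x`, `x + 1` with `x ≠ 1`. They give a root `r` for which
`r ^ 2 - c ^ 2` is a nonzero square. The cubic then splits with distinct roots, each coming from a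
pure solution, and its square discriminant produces the mixed one (`four_le_differenceCount`). -/

section SquaresAndSquareRoots

variable {F : Type*} [Field F]

/-! ### Squares when `-1` is a nonsquare, and uniqueness of the quartic root. -/

/-- Properties of a finite field of characteristic seven in which `-1` is not a square. -/
structure IsNonresidueSeven (F : Type*) [Field F] : Prop where
  seven : (7 : F) = 0
  sq_add_sq : ∀ a b : F, a ^ 2 + b ^ 2 = 0 → a = 0
  isSquare_or : ∀ a : F, IsSquare a ∨ IsSquare (-a)

/-- `f x` is a square which is a fourth root of `x` or of `-x`. -/
structure IsQuarticRoot (f : F → F) : Prop where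
  isSquare : ∀ x, IsSquare (f x)
  pow_four : ∀ x, f x ^ 4 = x ∨ f x ^ 4 = -x

theorem IsNonresidueSeven.eq_zero_of_add (hF : IsNonresidueSeven F) {u v : F}
    (hu : IsSquare u) (hv : IsSquare v) (h : u + v = 0) : u = 0 := by
  obtain ⟨a, rfl⟩ := hu
  obtain ⟨b, rfl⟩ := hv
  have := hF.sq_add_sq a b (by linear_combination h)
  simp [this]

/-- Taking square roots twice leaves only `u = ±v`, because `a ^ 2 = -b ^ 2` forces `a = b = 0`; two
squares that are opposite both vanish. -/
theorem IsNonresidueSeven.eq_or_neg_of_pow_four (hF : IsNonresidueSeven F) {u v : F}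
    (hu : IsSquare u) (hv : IsSquare v) (h : u ^ 4 = v ^ 4 ∨ u ^ 4 = -v ^ 4) : u = v := by
  have key : ∀ a b : F, a ^ 2 = b ^ 2 ∨ a ^ 2 = -b ^ 2 → a = b ∨ a = -b := by
    rintro a b (h | h)
    · exact sq_eq_sq_iff_eq_or_eq_neg.mp h
    · have ha := hF.sq_add_sq a b (by linear_combination h)
      have hb := hF.sq_add_sq b a (by linear_combination h)
      simp [ha, hb]
  have h2 := key (u ^ 2) (v ^ 2) (by convert h using 2 <;> ring)
  rcases key u v h2 with h | h
  · exact h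
  · have h1 := hF.eq_zero_of_add hu hv (by linear_combination h)
    rw [h1] at h ⊢
    linear_combination -h

theorem IsQuarticRoot.eq_of_pow (hF : IsNonresidueSeven F) {f : F → F} (hf : IsQuarticRoot f)
    {x u : F} (hu : IsSquare u) (h : u ^ 4 = x ∨ u ^ 4 = -x) : f x = u := by
  apply hF.eq_or_neg_of_pow_four (hf.isSquare x) hu
  rcases h with h | h <;> rcases hf.pow_four x with h' | h' <;> rw [h, h'] <;> simp

theorem isSquare_of_mul_eq_sq {a b z : F} (ha : IsSquare a) (ha0 : a ≠ 0) (h : a * b = z ^ 2) :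
    IsSquare b := by
  have : b = z ^ 2 / a := by field_simp; linear_combination h
  rw [this]
  exact (IsSquare.sq z).div ha

/-! ### Pure and mixed solutions. -/

/-- The two signs agree. -/
def IsPure (f : F → F) (x : F) : Prop :=
  (f x ^ 4 = x ∧ f (x + 1) ^ 4 = x + 1) ∨ (f x ^ 4 = -x ∧ f (x + 1) ^ 4 = -(x + 1))

/-- The two signs differ. -/
def IsMixed (f : F → F) (x : F) : Prop :=
  f x ≠ 0 ∧ f (x + 1) ≠ 0 ∧
  ((f x ^ 4 = x ∧ f (x + 1) ^ 4 = -(x + 1)) ∨ (f x ^ 4 = -x ∧ f (x + 1) ^ 4 = x + 1))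

theorem IsQuarticRoot.isPure_or_isMixed {f : F → F} (hf : IsQuarticRoot f) (x : F) :
    IsPure f x ∨ IsMixed f x := by
  unfold IsPure IsMixed
  by_cases h0 : f x = 0
  · have hx : x = 0 := by rcases hf.pow_four x with h | h <;> simpa [h0] using h.symm
    rcases hf.pow_four (x + 1) with h | h <;> simp_all
  by_cases h1 : f (x + 1) = 0
  · have hx : x + 1 = 0 := by
      rcases hf.pow_four (x + 1) with h | h
      · simpa [h1] using h.symm
      · simp only [h1] at h; linear_combination h
    rcases hf.pow_four x with h | h <;> simp_all
  rcases hf.pow_four x with h | h <;> rcases hf.pow_four (x + 1) with h' | h' <;> tauto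

theorem IsNonresidueSeven.not_isPure_of_isMixed (hF : IsNonresidueSeven F) {f : F → F} {x : F}
    (h : IsMixed f x) : ¬ IsPure f x := by
  have h7 := hF.seven
  have h2 : ∀ y : F, y = -y → y = 0 := fun y hy => by linear_combination 4 * hy - y * h7
  obtain ⟨hu, hv, h⟩ := h
  rintro (⟨h1, h3⟩ | ⟨h1, h3⟩) <;> rcases h with ⟨h4, h5⟩ | ⟨h4, h5⟩
  · exact hv (pow_eq_zero_iff (n := 4) (by norm_num) |>.mp (by
      rw [h3]; exact h2 _ (by rw [← h5, h3])))
  · exact hu (pow_eq_zero_iff (n := 4) (by norm_num) |>.mp (by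
      rw [h1]; exact h2 _ (by rw [← h4, h1])))
  · have : x = 0 := h2 x (by rw [← h1, h4])
    exact hu (pow_eq_zero_iff (n := 4) (by norm_num) |>.mp (by rw [h4, this]))
  · have : x + 1 = 0 := h2 _ (by rw [← h3, h5])
    exact hv (pow_eq_zero_iff (n := 4) (by norm_num) |>.mp (by rw [h5, this]))

/-! ### Pure solutions and the cubic. -/

open Classical in
/-- The root of `s * c * (s ^ 2 + c ^ 2) = 1` attached to a pure solution. -/
noncomputable def pureRoot (f : F → F) (c x : F) : F :=
  if f x ^ 4 = x then f x + c else -(f x + c)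

theorem pureRoot_spec (hF : IsNonresidueSeven F) {f : F → F} {c x : F} (h : IsPure f x)
    (hc : f (x + 1) - f x = 2 * c) :
    pureRoot f c x * c * (pureRoot f c x ^ 2 + c ^ 2) = 1 := by
  have h7 := hF.seven
  have hv : f (x + 1) = f x + 2 * c := by linear_combination hc
  unfold pureRoot
  unfold IsPure at h
  rw [hv] at h
  generalize f x = u at *
  split_ifs with h1
  · rcases h with ⟨h2, h3⟩ | ⟨h2, h3⟩
    · linear_combination h3 - h2 - (u + c) * c * ((u + c) ^ 2 + c ^ 2) * h7
    · have hx : x = 0 := by linear_combination 4 * h2 - 4 * h1 - x * h7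
      have := hF.sq_add_sq 1 ((u + 2 * c) ^ 2) (by rw [hx] at h3; linear_combination h3)
      exact absurd this one_ne_zero
  · rcases h with ⟨h2, h3⟩ | ⟨h2, h3⟩
    · exact absurd h2 h1
    · linear_combination h2 - h3 + (u + c) * c * ((u + c) ^ 2 + c ^ 2) * h7

/-- The root determines `f x` up to the sign choice, and opposite choices would make `f x + f (y +
1)` and `f y + f (x + 1)` vanish; these are sums of squares, so `c = 0`. -/
theorem pureRoot_injOn (hF : IsNonresidueSeven F) {f : F → F} (hf : IsQuarticRoot f) {c x y : F}
    (hc0 : c ≠ 0) (hx : f (x + 1) - f x = 2 * c) (hy : f (y + 1) - f y = 2 * c)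
    (h : pureRoot f c x = pureRoot f c y) : x = y := by
  have h7 := hF.seven
  have key : ∀ x y : F, f (x + 1) - f x = 2 * c → f (y + 1) - f y = 2 * c →
      f x + c = -(f y + c) → False := by
    intro x y hx hy h
    have h1 := hF.eq_zero_of_add (hf.isSquare x) (hf.isSquare (y + 1)) (by linear_combination h + hy)
    have h2 := hF.eq_zero_of_add (hf.isSquare y) (hf.isSquare (x + 1)) (by linear_combination h + hx)
    rw [h1, h2] at h
    apply hc0
    linear_combination 4 * h - c * h7
  unfold pureRoot at h
  have hx4 := hf.pow_four x
  have hy4 := hf.pow_four y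
  split_ifs at h with h1 h2 h2
  · have : f x = f y := by linear_combination h
    rw [← h1, ← h2, this]
  · exact (key x y hx hy h).elim
  · exact (key x y hx hy (by linear_combination -h)).elim
  · have : f x = f y := by linear_combination -h
    have h3 := hx4.resolve_left h1
    have h4 := hy4.resolve_left h2
    rw [this] at h3
    linear_combination h3 - h4

/-! ### Mixed solutions and the biquadratic equations. -/

theorem mixed_quadratic (hF : IsNonresidueSeven F) {f : F → F} {c x : F} (h : IsMixed f x)
    (hc : f (x + 1) - f x = 2 * c) :
    (f x + c) ^ 4 - (f x + c) ^ 2 * c ^ 2 + c ^ 4 = 4 ∨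
    (f x + c) ^ 4 - (f x + c) ^ 2 * c ^ 2 + c ^ 4 = -4 := by
  have h7 := hF.seven
  have hv : f (x + 1) = f x + 2 * c := by linear_combination hc
  obtain ⟨-, -, h⟩ := h
  rw [hv] at h
  generalize f x = u at *
  rcases h with ⟨h, h'⟩ | ⟨h, h'⟩
  · right; grind
  · left; grind

/-- Squares `s - c`, `s + c`, `s' - c`, `s' + c` for which `s` and `s'` solve the biquadratic
equations with constants of opposite sign. -/
theorem mixed_opposite (hF : IsNonresidueSeven F) {c s s' e : F}
    (hu : IsSquare (s' - c)) (hv : IsSquare (s' + c)) (hu0 : s' - c ≠ 0) (hv0 : s' + c ≠ 0)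
    (h : s ^ 4 - s ^ 2 * c ^ 2 + c ^ 4 = e) (h' : s' ^ 4 - s' ^ 2 * c ^ 2 + c ^ 4 = -e) :
    False := by
  have h7 := hF.seven
  -- Adding the two equations and completing the square modulo 7 gives `s' ^ 2 * (s' ^ 2 - c ^ 2) +
  -- (s ^ 2 - 4 * c ^ 2) ^ 2 = 0`.
  have h0 : s' ^ 2 * ((s' - c) * (s' + c)) = 0 :=
    hF.eq_zero_of_add ((IsSquare.sq s').mul (hu.mul hv)) (IsSquare.sq (s ^ 2 - 4 * c ^ 2))
      (by grind)
  have hs : s' = 0 := by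
    simpa [hu0, hv0] using h0
  apply hu0
  exact hF.eq_zero_of_add hu hv (by rw [hs]; ring)

theorem mixed_same (hF : IsNonresidueSeven F) {c s s' e : F}
    (hu : IsSquare (s - c)) (hv : IsSquare (s + c)) (hu0 : s - c ≠ 0) (hv0 : s + c ≠ 0)
    (hu' : IsSquare (s' - c))
    (h : s ^ 4 - s ^ 2 * c ^ 2 + c ^ 4 = e) (h' : s' ^ 4 - s' ^ 2 * c ^ 2 + c ^ 4 = e) :
    s = s' := by
  have h1 : (s ^ 2 - s' ^ 2) * (s ^ 2 + s' ^ 2 - c ^ 2) = 0 := by linear_combination h - h'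
  rcases mul_eq_zero.mp h1 with h1 | h1
  · rcases sq_eq_sq_iff_eq_or_eq_neg.mp (sub_eq_zero.mp h1) with h1 | h1
    · exact h1
    · exact absurd (hF.eq_zero_of_add hv hu' (by rw [h1]; ring)) hv0
  -- The second factor reads `(s - c) * (s + c) + s' ^ 2 = 0`, a vanishing sum of squares.
  · have := hF.eq_zero_of_add (hu.mul hv) (IsSquare.sq s') (by linear_combination h1)
    simp [hu0, hv0] at this

theorem isMixed_unique (hF : IsNonresidueSeven F) {f : F → F} (hf : IsQuarticRoot f) {c x y : F}
    (hx : f (x + 1) - f x = 2 * c) (hy : f (y + 1) - f y = 2 * c)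
    (hmx : IsMixed f x) (hmy : IsMixed f y) : x = y := by
  have h7 := hF.seven
  have hl : ∀ z, f z + c - c = f z := fun z => by ring
  have hr : ∀ z, f (z + 1) - f z = 2 * c → f z + c + c = f (z + 1) := fun z hz => by
    linear_combination -hz
  have hs : f x = f y := by
    rcases mixed_quadratic hF hmx hx with h1 | h1 <;> rcases mixed_quadratic hF hmy hy with h2 | h2
    · apply add_right_cancel (b := c)
      apply mixed_same hF _ _ _ _ _ h1 h2
      all_goals simp only [hl, hr x hx]
      exacts [hf.isSquare _, hf.isSquare _, hmx.1, hmx.2.1, hf.isSquare _]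
    · exfalso
      apply mixed_opposite hF _ _ _ _ h1 h2
      all_goals simp only [hl, hr y hy]
      exacts [hf.isSquare _, hf.isSquare _, hmy.1, hmy.2.1]
    · exfalso
      apply mixed_opposite hF _ _ _ _ h1 (by rw [h2]; ring)
      all_goals simp only [hl, hr y hy]
      exacts [hf.isSquare _, hf.isSquare _, hmy.1, hmy.2.1]
    · apply add_right_cancel (b := c)
      apply mixed_same hF _ _ _ _ _ h1 h2
      all_goals simp only [hl, hr x hx]
      exacts [hf.isSquare _, hf.isSquare _, hmx.1, hmx.2.1, hf.isSquare _]
  have hs' : f (x + 1) = f (y + 1) := by linear_combination hx - hy + hs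
  obtain ⟨-, -, h⟩ := hmx
  obtain ⟨-, -, h'⟩ := hmy
  rw [hs, hs'] at h
  generalize f y = u at *
  generalize f (y + 1) = v at *
  rcases h with ⟨h1, h2⟩ | ⟨h1, h2⟩ <;> rcases h' with ⟨h3, h4⟩ | ⟨h3, h4⟩ <;> grind

/-! ### The upper bound. -/

theorem card_le_three_of_cubic (S : Finset F) {c : F} (hc : c ≠ 0)
    (h : ∀ s ∈ S, s * c * (s ^ 2 + c ^ 2) = 1) : S.card ≤ 3 := by
  open Polynomial in
  let p : F[X] := X ^ 3 + C (c ^ 2) * X - C c⁻¹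
  have hp : p.natDegree = 3 := by simp only [p]; compute_degree!
  have hp0 : p ≠ 0 := by
    intro h0
    simp [h0] at hp
  rw [← hp]
  apply Polynomial.card_le_degree_of_subset_roots
  intro s hs
  rw [Polynomial.mem_roots hp0]
  have := h s hs
  simp only [p, Polynomial.IsRoot.def, Polynomial.eval_sub, Polynomial.eval_add,
    Polynomial.eval_mul, Polynomial.eval_pow, Polynomial.eval_X, Polynomial.eval_C]
  field_simp
  linear_combination this

theorem differenceCount_le_four [Fintype F] [DecidableEq F] (hF : IsNonresidueSeven F)
    {f : F → F} (hf : IsQuarticRoot f) (b : F) : differenceCount f 1 b ≤ 4 := by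
  classical
  have h7 := hF.seven
  unfold differenceCount
  obtain ⟨c, rfl⟩ : ∃ c, b = 2 * c := ⟨4 * b, by linear_combination -b * h7⟩
  by_cases hc : c = 0
  · subst hc
    refine (Finset.card_le_one.mpr ?_).trans (by norm_num)
    -- Equal values give `x + 1 = ±x`; only `x + 1 = -x` is possible, and it means `x = 3` in
    -- characteristic 7.
    have key : ∀ x, f (x + 1) - f x = 2 * 0 → x = 3 := by
      intro x hx
      have hx' : f (x + 1) = f x := by linear_combination hx
      have h1 := hf.pow_four x
      have h2 := hf.pow_four (x + 1)
      rw [hx'] at h2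
      rcases h1 with h1 | h1 <;> rcases h2 with h2 | h2
      · exact absurd (by linear_combination h1 - h2 : (1 : F) = 0) one_ne_zero
      · linear_combination 4 * (h2 - h1) - (x + 1) * h7
      · linear_combination 4 * (h1 - h2) - (x + 1) * h7
      · exact absurd (by linear_combination h2 - h1 : (1 : F) = 0) one_ne_zero
    intro x hx y hy
    rw [key x (Finset.mem_filter.mp hx).2, key y (Finset.mem_filter.mp hy).2]
  set S := Finset.univ.filter (fun x : F => f (x + 1) - f x = 2 * c) with hS
  have hmem : ∀ x ∈ S, f (x + 1) - f x = 2 * c := fun x hx => (Finset.mem_filter.mp hx).2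
  rw [← Finset.card_filter_add_card_filter_not (s := S) (IsPure f)]
  have h1 : (S.filter (IsPure f)).card ≤ 3 := by
    rw [← Finset.card_image_of_injOn (f := pureRoot f c)]
    · apply card_le_three_of_cubic _ hc
      intro s hs
      obtain ⟨x, hx, rfl⟩ := Finset.mem_image.mp hs
      rw [Finset.mem_filter] at hx
      exact pureRoot_spec hF hx.2 (hmem x hx.1)
    · intro x hx y hy h
      rw [Finset.mem_coe, Finset.mem_filter] at hx hy
      exact pureRoot_injOn hF hf hc (hmem x hx.1) (hmem y hy.1) h
  have h2 : (S.filter (fun x => ¬ IsPure f x)).card ≤ 1 := by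
    rw [Finset.card_le_one]
    intro x hx y hy
    rw [Finset.mem_filter] at hx hy
    exact isMixed_unique hF hf (hmem x hx.1) (hmem y hy.1)
      ((hf.isPure_or_isMixed x).resolve_left hx.2) ((hf.isPure_or_isMixed y).resolve_left hy.2)
  omega

/-! ### Constructing four solutions. -/

/-- Since `(r - c) * (r + c)` is a nonzero square, `r - c` and `r + c` are both squares or both
negatives of squares. They serve as `f x` and `f (x + 1)` in the first case; in the second, negate
and swap them. -/
theorem exists_isPure_of_root (hF : IsNonresidueSeven F) {f : F → F} (hf : IsQuarticRoot f)
    {r c z : F} (h : r * c * (r ^ 2 + c ^ 2) = 1) (hz : z ≠ 0) (hrz : r ^ 2 - c ^ 2 = z ^ 2) :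
    ∃ x, f (x + 1) - f x = 2 * c ∧ IsPure f x ∧ pureRoot f c x = r := by
  have h7 := hF.seven
  have hz' : (r - c) * (r + c) = z ^ 2 := by linear_combination hrz
  have hne : (r - c) * (r + c) ≠ 0 := by rw [hz']; exact pow_ne_zero _ hz
  have hu0 := left_ne_zero_of_mul hne
  have hv0 := right_ne_zero_of_mul hne
  have h4 : (r + c) ^ 4 = (r - c) ^ 4 + 1 := by
    linear_combination h + r * c * (r ^ 2 + c ^ 2) * h7
  rcases hF.isSquare_or (r - c) with hu | hu
  · have hv := isSquare_of_mul_eq_sq hu hu0 hz'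
    have hfu : f ((r - c) ^ 4) = r - c := hf.eq_of_pow hF hu (Or.inl rfl)
    have hfv : f ((r - c) ^ 4 + 1) = r + c := hf.eq_of_pow hF hv (Or.inl h4)
    refine ⟨(r - c) ^ 4, ?_, Or.inl ?_, ?_⟩
    · rw [hfu, hfv]; ring
    · rw [hfu, hfv]; exact ⟨rfl, h4⟩
    · rw [pureRoot, hfu, if_pos rfl]; ring
  · have hv : IsSquare (-(r + c)) :=
      isSquare_of_mul_eq_sq hu (neg_ne_zero.mpr hu0) (z := z) (by linear_combination hz')
    have hfu : f (-(r + c) ^ 4) = -(r + c) := hf.eq_of_pow hF hv (Or.inr (by ring))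
    have hfv : f (-(r + c) ^ 4 + 1) = -(r - c) :=
      hf.eq_of_pow hF hu (Or.inr (by linear_combination -h4))
    refine ⟨-(r + c) ^ 4, ?_, Or.inr ?_, ?_⟩
    · rw [hfu, hfv]; ring
    · rw [hfu, hfv]; exact ⟨by ring, by linear_combination -h4⟩
    · rw [pureRoot, hfu, if_neg]
      · ring
      · intro h0
        apply hv0
        rw [← pow_eq_zero_iff (n := 4) (by norm_num)]
        linear_combination 4 * h0 - (r + c) ^ 4 * h7

theorem exists_isMixed_of_biquadratic (hF : IsNonresidueSeven F) {f : F → F}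
    (hf : IsQuarticRoot f) {s c z e : F} (he : e = 4 ∨ e = -4) (hz : z ≠ 0)
    (h : s ^ 4 - s ^ 2 * c ^ 2 + c ^ 4 = e) (hsz : s ^ 2 - c ^ 2 = z ^ 2) :
    ∃ x, f (x + 1) - f x = 2 * c ∧ IsMixed f x := by
  have h7 := hF.seven
  -- Both conditions are even in `s`, so its sign can be chosen to make `s - c` a square.
  obtain ⟨s, h, hsz, hu⟩ : ∃ s : F, s ^ 4 - s ^ 2 * c ^ 2 + c ^ 4 = e ∧ s ^ 2 - c ^ 2 = z ^ 2 ∧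
      IsSquare (s - c) := by
    rcases hF.isSquare_or (s - c) with hu | hu
    · exact ⟨s, h, hsz, hu⟩
    · refine ⟨-s, by linear_combination h, by linear_combination hsz, ?_⟩
      by_cases h0 : s - c = 0
      · have : z ^ 2 = 0 := by linear_combination (s + c) * h0 - hsz
        exact absurd (pow_eq_zero_iff (n := 2) (by norm_num) |>.mp this) hz
      · exact isSquare_of_mul_eq_sq hu (neg_ne_zero.mpr h0) (z := z) (by linear_combination hsz)
  have hz' : (s - c) * (s + c) = z ^ 2 := by linear_combination hsz
  have hne : (s - c) * (s + c) ≠ 0 := by rw [hz']; exact pow_ne_zero _ hz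
  have hu0 := left_ne_zero_of_mul hne
  have hv0 := right_ne_zero_of_mul hne
  have hv := isSquare_of_mul_eq_sq hu hu0 hz'
  have h4 : (s + c) ^ 4 + (s - c) ^ 4 = 2 * e := by
    linear_combination 2 * h + 2 * s ^ 2 * c ^ 2 * h7
  rcases he with rfl | rfl
  · have h5 : (s + c) ^ 4 = -(s - c) ^ 4 + 1 := by linear_combination h4 + h7
    have hfu : f (-(s - c) ^ 4) = s - c := hf.eq_of_pow hF hu (Or.inr (by ring))
    have hfv : f (-(s - c) ^ 4 + 1) = s + c := hf.eq_of_pow hF hv (Or.inl h5)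
    refine ⟨-(s - c) ^ 4, ?_, ?_, ?_, Or.inr ?_⟩ <;> try rw [hfu]
    · rw [hfv]; ring
    · exact hu0
    · exact hfv ▸ hv0
    · rw [hfv]; exact ⟨by ring, h5⟩
  · have h5 : (s + c) ^ 4 = -((s - c) ^ 4 + 1) := by linear_combination h4 - h7
    have hfu : f ((s - c) ^ 4) = s - c := hf.eq_of_pow hF hu (Or.inl rfl)
    have hfv : f ((s - c) ^ 4 + 1) = s + c := hf.eq_of_pow hF hv (Or.inr h5)
    refine ⟨(s - c) ^ 4, ?_, ?_, ?_, Or.inl ?_⟩ <;> try rw [hfu]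
    · rw [hfv]; ring
    · exact hu0
    · exact hfv ▸ hv0
    · rw [hfv]; exact ⟨rfl, h5⟩

/-- As a quadratic in `t = s ^ 2`, the biquadratic has roots `4 * c ^ 2 ± y` with `y ^ 2 = c ^ 4 +
e`. Their product `c ^ 4 - e` is minus a nonzero square, so one root `t` is a square and the other,
`t'`, is minus a square; then `t - c ^ 2 = -t'` is a square as well. -/
theorem exists_isMixed_of_isSquare (hF : IsNonresidueSeven F) {f : F → F}
    (hf : IsQuarticRoot f) {c z e : F} (he : e = 4 ∨ e = -4) (hz : z ≠ 0)
    (hplus : IsSquare (c ^ 4 + e)) (hminus : c ^ 4 - e = -z ^ 2) :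
    ∃ x, f (x + 1) - f x = 2 * c ∧ IsMixed f x := by
  have h7 := hF.seven
  obtain ⟨y, hy⟩ := hplus
  have key : ∀ t t' : F, t + t' = c ^ 2 → t * t' = -z ^ 2 → t ^ 2 - t * c ^ 2 + c ^ 4 = e →
      IsSquare t → ∃ x, f (x + 1) - f x = 2 * c ∧ IsMixed f x := by
    intro t t' hadd hmul ht hsq
    have hne : t * t' ≠ 0 := by rw [hmul]; exact neg_ne_zero.mpr (pow_ne_zero _ hz)
    obtain ⟨w, hw⟩ := isSquare_of_mul_eq_sq (b := -t') (z := z) hsq (left_ne_zero_of_mul hne)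
      (by linear_combination -hmul)
    obtain ⟨s, rfl⟩ := hsq
    refine exists_isMixed_of_biquadratic hF hf (s := s) (z := w) he ?_
      (by linear_combination ht) (by linear_combination hadd + hw)
    rintro rfl
    exact right_ne_zero_of_mul hne (by linear_combination -hw)
  have hadd : (4 * c ^ 2 + y) + (4 * c ^ 2 - y) = c ^ 2 := by linear_combination c ^ 2 * h7
  have hmul : (4 * c ^ 2 + y) * (4 * c ^ 2 - y) = -z ^ 2 := by
    linear_combination hy + hminus + 2 * c ^ 4 * h7
  rcases hF.isSquare_or (4 * c ^ 2 + y) with h | h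
  · exact key _ _ hadd hmul (by linear_combination -hy + (2 * c ^ 4 + c ^ 2 * y) * h7) h
  · have hne : (4 * c ^ 2 + y) * (4 * c ^ 2 - y) ≠ 0 := by
      rw [hmul]; exact neg_ne_zero.mpr (pow_ne_zero _ hz)
    exact key (4 * c ^ 2 - y) (4 * c ^ 2 + y) (by linear_combination hadd) (by linear_combination hmul)
      (by linear_combination -hy + (2 * c ^ 4 - c ^ 2 * y) * h7)
      (isSquare_of_mul_eq_sq (z := z) h (neg_ne_zero.mpr (left_ne_zero_of_mul hne))
        (by linear_combination -hmul))

/-- Modulo 7, `(c ^ 4 + 4) * (c ^ 4 - 4) = 16 * (4 * c ^ 8 - 1)` is minus a nonzero square. So for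
one choice `e = ±4`, `c ^ 4 + e` is a square and `c ^ 4 - e` is minus a square. -/
theorem exists_isMixed_of_discriminant (hF : IsNonresidueSeven F) {f : F → F}
    (hf : IsQuarticRoot f) {c z : F} (hz : z ≠ 0) (h : 4 * c ^ 8 - 1 = -z ^ 2) :
    ∃ x, f (x + 1) - f x = 2 * c ∧ IsMixed f x := by
  have h7 := hF.seven
  have hprod : (c ^ 4 + 4) * (c ^ 4 - 4) = -(4 * z) ^ 2 := by
    linear_combination 16 * h - (9 * c ^ 8) * h7
  have hne : (c ^ 4 + 4) * (c ^ 4 - 4) ≠ 0 := by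
    rw [hprod, neg_ne_zero]
    refine pow_ne_zero _ (mul_ne_zero ?_ hz)
    intro h4
    exact one_ne_zero (α := F) (by linear_combination 2 * h4 - h7)
  have hp0 := left_ne_zero_of_mul hne
  have hm0 := right_ne_zero_of_mul hne
  rcases hF.isSquare_or (c ^ 4 + 4) with hp | hp
  · obtain ⟨w, hw⟩ := isSquare_of_mul_eq_sq (b := -(c ^ 4 - 4)) (z := 4 * z) hp hp0
      (by linear_combination -hprod)
    refine exists_isMixed_of_isSquare hF hf (z := w) (Or.inl rfl) ?_ hp (by linear_combination -hw)
    rintro rfl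
    exact hm0 (by linear_combination -hw)
  · have hm := isSquare_of_mul_eq_sq (b := c ^ 4 - 4) (z := 4 * z) hp (neg_ne_zero.mpr hp0)
      (by linear_combination -hprod)
    obtain ⟨w, hw⟩ := hp
    refine exists_isMixed_of_isSquare hF hf (z := w) (Or.inr rfl) ?_ (by convert hm using 1; ring)
      (by linear_combination -hw)
    rintro rfl
    exact hp0 (by linear_combination -hw)

/-- This rules out repeated roots of the cubic. Since `2 = 3 ^ 2`, equality would give `r = ±3 * c`;
every resulting case contradicts `-1` being a nonsquare, except `c = -3`, where `r - c = 1`. -/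
theorem sq_ne_two_mul_sq_of_root (hF : IsNonresidueSeven F) {r c : F}
    (h : r * c * (r ^ 2 + c ^ 2) = 1) (hu : IsSquare (r - c)) (hu1 : r - c ≠ 1) :
    r ^ 2 ≠ 2 * c ^ 2 := by
  have h7 := hF.seven
  intro h2
  have h3 : r ^ 2 = (3 * c) ^ 2 := by linear_combination h2 - c ^ 2 * h7
  rcases sq_eq_sq_iff_eq_or_eq_neg.mp h3 with rfl | rfl
  · have h4 : (c ^ 2 - 2) * (c ^ 2 + 2) = 0 := by
      linear_combination 4 * h - 17 * c ^ 4 * h7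
    rcases mul_eq_zero.mp h4 with h4 | h4
    · have h5 : c ^ 2 = 3 ^ 2 := by linear_combination h4 - h7
      rcases sq_eq_sq_iff_eq_or_eq_neg.mp h5 with rfl | rfl
      · exact one_ne_zero (hF.eq_zero_of_add (IsSquare.one) hu (by linear_combination h7))
      · exact hu1 (by linear_combination -h7)
    · have h5 := hF.sq_add_sq 3 c (by linear_combination h4 + h7)
      exact one_ne_zero (α := F) (by linear_combination h7 - 2 * h5)
  · exact one_ne_zero (hF.sq_add_sq 1 (3 * c ^ 2)
      (by linear_combination -h - 3 * c ^ 4 * h7))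

theorem four_le_differenceCount [Fintype F] [DecidableEq F] (hF : IsNonresidueSeven F)
    {f : F → F} (hf : IsQuarticRoot f) {x : F} (hx : IsSquare x) (hx' : IsSquare (x + 1))
    (hx0 : x ≠ 0) (hx1 : x + 1 ≠ 0) (hne1 : x ≠ 1) : ∃ b, 4 ≤ differenceCount f 1 b := by
  have h7 := hF.seven
  have hpow : ∀ y : F, IsSquare y → y ≠ 0 → f y ^ 4 = y := fun y hy hy0 =>
    (hf.pow_four y).resolve_right fun h => hy0 <|
      hF.eq_zero_of_add hy (v := f y ^ 4) ⟨f y ^ 2, by ring⟩ (by linear_combination h)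
  have hu4 := hpow x hx hx0
  have hv4 := hpow (x + 1) hx' hx1
  have hu := hf.isSquare x
  have hv := hf.isSquare (x + 1)
  -- `4` is the inverse of `2`: `c` and `r` are the half-difference and half-sum.
  obtain ⟨c, hc⟩ : ∃ c, c = 4 * (f (x + 1) - f x) := ⟨_, rfl⟩
  obtain ⟨r, hr⟩ : ∃ r, r = 4 * (f (x + 1) + f x) := ⟨_, rfl⟩
  have hrc : f x = r - c := by linear_combination hc - hr - f x * h7
  have hrc' : f (x + 1) = r + c := by linear_combination -hc - hr - f (x + 1) * h7
  rw [hrc] at hu hu4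
  rw [hrc'] at hv hv4
  have hroot : r * c * (r ^ 2 + c ^ 2) = 1 := by
    linear_combination hv4 - hu4 - r * c * (r ^ 2 + c ^ 2) * h7
  have hu1 : r - c ≠ 1 := fun h => hne1 (by rw [← hu4, h, one_pow])
  have hu0 : r - c ≠ 0 := fun h => hx0 (by rw [← hu4, h]; simp)
  have hv0 : r + c ≠ 0 := fun h => hx1 (by rw [← hv4, h]; simp)
  have hc0 : c ≠ 0 := by
    rintro rfl
    simp at hroot
  obtain ⟨w, hw⟩ := hu.mul hv
  have hw0 : w ≠ 0 := by
    rintro rfl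
    simp [hu0, hv0] at hw
  have hD := sq_ne_two_mul_sq_of_root hF hroot hu hu1
  have hz2 : -r + 4 * w ≠ 0 := fun h => hD (by
    linear_combination (r + 4 * w) * h + 2 * hw - 2 * w ^ 2 * h7)
  have hz3 : -r - 4 * w ≠ 0 := fun h => hD (by
    linear_combination (r - 4 * w) * h + 2 * hw - 2 * w ^ 2 * h7)
  have hdisc : 2 * c * w * (4 * r ^ 2 - w ^ 2) ≠ 0 := by
    have h2 : (2 : F) ≠ 0 := fun h => one_ne_zero (α := F) (by linear_combination h7 - 3 * h)
    refine mul_ne_zero (mul_ne_zero (mul_ne_zero h2 hc0) hw0) fun h => hD ?_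
    linear_combination 2 * hw - 2 * h + r ^ 2 * h7
  obtain ⟨x1, hx1, hp1, hr1⟩ := exists_isPure_of_root hF hf hroot hw0 (by linear_combination hw)
  -- With `w ^ 2 = r ^ 2 - c ^ 2`, the other roots of the cubic are `3 * r ± w`, and `(3 * r ± w) ^
  -- 2 - c ^ 2 = (-r ± 4 * w) ^ 2`.
  obtain ⟨x2, hx2, hp2, hr2⟩ := exists_isPure_of_root hF hf
    (r := 3 * r + w) (c := c) (z := -r + 4 * w)
    (by linear_combination hroot - c * (9 * r + w) * hw +
      c * (5 * r ^ 3 - r * c ^ 2 + 4 * r ^ 2 * w) * h7)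
    hz2 (by linear_combination hw + (r ^ 2 + 2 * r * w - 2 * w ^ 2) * h7)
  obtain ⟨x3, hx3, hp3, hr3⟩ := exists_isPure_of_root hF hf
    (r := 3 * r - w) (c := c) (z := -r - 4 * w)
    (by linear_combination hroot - c * (9 * r - w) * hw +
      c * (5 * r ^ 3 - r * c ^ 2 - 4 * r ^ 2 * w) * h7)
    hz3 (by linear_combination hw + (r ^ 2 - 2 * r * w - 2 * w ^ 2) * h7)
  -- The cubic `X ^ 3 + c ^ 2 * X - c⁻¹` has discriminant `(1 - 4 * c ^ 8) / c ^ 2` modulo 7, so `1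
  -- - 4 * c ^ 8` is the square of `c` times the product of the root differences, here `2 * c * w *
  -- (4 * r ^ 2 - w ^ 2)` up to sign.
  obtain ⟨x4, hx4, hm4⟩ := exists_isMixed_of_discriminant hF hf (c := c) hdisc (by
    linear_combination (r * c * (r ^ 2 + c ^ 2) + 1) * hroot -
      4 * c ^ 2 * (16 * r ^ 4 - 8 * r ^ 2 * (w ^ 2 + (r ^ 2 - c ^ 2)) +
        (w ^ 4 + w ^ 2 * (r ^ 2 - c ^ 2) + (r ^ 2 - c ^ 2) ^ 2)) * hw +
      (5 * r ^ 6 * c ^ 2 - 2 * r ^ 4 * c ^ 4 - 3 * r ^ 2 * c ^ 6) * h7)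
  refine ⟨2 * c, ?_⟩
  have hpm : ∀ y, IsPure f y → y ≠ x4 := by
    rintro y hy rfl
    exact hF.not_isPure_of_isMixed hm4 hy
  have h12 : x1 ≠ x2 := by
    rintro rfl
    exact hz3 (by linear_combination 4 * (hr2 - hr1) + r * h7)
  have h13 : x1 ≠ x3 := by
    rintro rfl
    exact hz2 (by linear_combination 4 * (hr3 - hr1) + r * h7)
  have h23 : x2 ≠ x3 := by
    rintro rfl
    exact hw0 (by linear_combination 4 * (hr3 - hr2) - w * h7)
  have hcard : ({x1, x2, x3, x4} : Finset F).card = 4 :=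
    Finset.card_eq_four.mpr
      ⟨x1, x2, x3, x4, h12, h13, hpm _ hp1, h23, hpm _ hp2, hpm _ hp3, rfl⟩
  rw [← hcard, differenceCount]
  apply Finset.card_le_card
  intro y hy
  simp only [Finset.mem_insert, Finset.mem_singleton] at hy
  rw [Finset.mem_filter]
  refine ⟨Finset.mem_univ _, ?_⟩
  rcases hy with rfl | rfl | rfl | rfl <;> assumption

/-- Parametrize `Y ^ 2 - X ^ 2 = 1` by `k`; the degenerate values of `k` all lie in the prime field,
so any `k` outside it works. -/
theorem exists_consecutive_squares [Fintype F] (hF : IsNonresidueSeven F)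
    (hcard : 7 < Fintype.card F) :
    ∃ x : F, IsSquare x ∧ IsSquare (x + 1) ∧ x ≠ 0 ∧ x + 1 ≠ 0 ∧ x ≠ 1 := by
  classical
  have h7 := hF.seven
  obtain ⟨k, hk⟩ : ∃ k : F, k ∉ Finset.univ.image (fun i : Fin 7 => ((i : ℕ) : F)) := by
    by_contra! h
    have h1 : (Finset.univ : Finset F) ⊆ Finset.univ.image (fun i : Fin 7 => ((i : ℕ) : F)) :=
      fun k _ => h k
    have h2 := (Finset.card_le_card h1).trans Finset.card_image_le
    rw [Finset.card_univ, Finset.card_univ, Fintype.card_fin] at h2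
    omega
  have hk' : ∀ i : ℕ, i < 7 → k - i ≠ 0 := fun i hi h => hk
    (Finset.mem_image.mpr ⟨⟨i, hi⟩, Finset.mem_univ _, (sub_eq_zero.mp h).symm⟩)
  have k0 := hk' 0 (by norm_num)
  have k1 := hk' 1 (by norm_num)
  have k2 := hk' 2 (by norm_num)
  have k3 := hk' 3 (by norm_num)
  have k4 := hk' 4 (by norm_num)
  have k5 := hk' 5 (by norm_num)
  have k6 := hk' 6 (by norm_num)
  push_cast at k0 k1 k2 k3 k4 k5 k6
  rw [sub_zero] at k0
  have hinv : k * k⁻¹ = 1 := mul_inv_cancel₀ k0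
  have hz : (4 * (k⁻¹ - k)) ^ 2 + 1 = (4 * (k⁻¹ + k)) ^ 2 := by
    linear_combination -64 * hinv - 9 * h7
  refine ⟨(4 * (k⁻¹ - k)) ^ 2, IsSquare.sq _, hz ▸ IsSquare.sq _, ?_, ?_, ?_⟩
  · intro h
    have h1 := pow_eq_zero_iff (n := 2) (by norm_num) |>.mp h
    exact mul_ne_zero k1 k6
      (by linear_combination -2 * k * h1 + 8 * hinv + (-k ^ 2 - k + 2) * h7)
  · intro h
    exact one_ne_zero (hF.sq_add_sq 1 (4 * (k⁻¹ - k)) (by linear_combination h))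
  · intro h
    have h1 : (4 * (k⁻¹ - k)) ^ 2 = 1 ^ 2 := by linear_combination h
    rcases sq_eq_sq_iff_eq_or_eq_neg.mp h1 with h1 | h1
    · exact mul_ne_zero k2 k3
        (by linear_combination -2 * k * h1 + 8 * hinv + (-k ^ 2 - k + 2) * h7)
    · exact mul_ne_zero k4 k5
        (by linear_combination -2 * k * h1 + 8 * hinv + (-k ^ 2 - k + 4) * h7)

end SquaresAndSquareRoots

/-! ### The power map as a quartic root. -/

section PowerMap

variable {F : Type*} [Field F] [Fintype F]

theorem isNonresidueSeven_of_card {n : ℕ} (hn : Odd n) (hF : Fintype.card F = 7 ^ n) :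
    IsNonresidueSeven F := by
  classical
  have h7 : (7 : F) = 0 := by
    have h := FiniteField.cast_card_eq_zero F
    rw [hF] at h
    push_cast at h
    exact pow_eq_zero_iff hn.pos.ne' |>.mp h
  have hmod : Fintype.card F % 4 = 3 := by
    obtain ⟨m, rfl⟩ := hn
    rw [hF, pow_succ, pow_mul, Nat.mul_mod, Nat.pow_mod]
    norm_num
  have hneg : ¬ IsSquare (-1 : F) := by
    rw [FiniteField.isSquare_neg_one_iff]
    simp [hmod]
  have hchar : ringChar F ≠ 2 := by
    intro h
    have h2 := FiniteField.even_card_of_char_two h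
    omega
  refine ⟨h7, ?_, ?_⟩
  · intro a b h
    by_contra ha
    refine hneg ⟨b / a, ?_⟩
    field_simp
    linear_combination -h
  · intro a
    by_cases ha0 : a = 0
    · exact Or.inl (ha0 ▸ IsSquare.zero)
    by_contra! h
    have h1 := quadraticChar_neg_one_iff_not_isSquare.mpr h.1
    have h2 := quadraticChar_neg_one_iff_not_isSquare.mpr h.2
    have h3 := quadraticChar_neg_one_iff_not_isSquare.mpr hneg
    rw [← neg_one_mul, map_mul, h1, h3] at h2
    norm_num at h2

theorem isQuarticRoot_pow {n : ℕ} (hn : Odd n) (hF : Fintype.card F = 7 ^ n) :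
    IsQuarticRoot (fun x : F => x ^ ((7 ^ n + 1) / 8 + (7 ^ n - 1) / 2)) := by
  have hmod : 7 ^ n % 16 = 7 := by
    obtain ⟨m, rfl⟩ := hn
    rw [pow_succ, pow_mul, Nat.mul_mod, Nat.pow_mod]
    norm_num
  obtain ⟨k, hk⟩ : ∃ k, 7 ^ n = 16 * k + 7 := ⟨7 ^ n / 16, by omega⟩
  have hd : (7 ^ n + 1) / 8 + (7 ^ n - 1) / 2 = 2 * (5 * k + 2) := by omega
  rw [hd]
  refine ⟨fun x => ⟨x ^ (5 * k + 2), by ring⟩, fun x => ?_⟩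
  -- It suffices that `x ^ (8 * d) = x ^ 2`; with `q = 16 * k + 7`, `8 * d = 5 * (q - 1) + 2`.
  rw [← sq_eq_sq_iff_eq_or_eq_neg]
  have hq : x ^ (16 * k + 7) = x := by rw [← hk, ← hF]; exact FiniteField.pow_card x
  calc ((x ^ (2 * (5 * k + 2))) ^ 4) ^ 2 = (x ^ (16 * k + 7)) ^ 4 * x ^ (16 * k + 4) := by ring
    _ = x ^ 4 * x ^ (16 * k + 4) := by rw [hq]
    _ = x ^ (16 * k + 7) * x := by ring
    _ = x ^ 2 := by rw [hq]; ring

theorem differenceCount_pow_eq [DecidableEq F] (d : ℕ) {a : F} (ha : a ≠ 0) (b : F) :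
    differenceCount (fun x : F => x ^ d) a b =
      differenceCount (fun x : F => x ^ d) 1 (b / a ^ d) := by
  unfold differenceCount
  refine Finset.card_bij' (fun x _ => x / a) (fun x _ => x * a) ?_ ?_ ?_ ?_
  · intro x hx
    rw [Finset.mem_filter] at hx ⊢
    refine ⟨Finset.mem_univ _, ?_⟩
    rw [← hx.2, sub_div, ← div_pow, ← div_pow, add_div, div_self ha]
  · intro x hx
    rw [Finset.mem_filter] at hx ⊢
    refine ⟨Finset.mem_univ _, ?_⟩
    rw [eq_div_iff (pow_ne_zero _ ha), sub_mul, ← mul_pow, ← mul_pow, add_mul, one_mul] at hx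
    exact hx.2
  · intro x _
    field_simp
  · intro x _
    field_simp

end PowerMap

theorem mainTheorem5 {F : Type*} [Field F] [Fintype F] [DecidableEq F]
    (n : ℕ) (hn : Odd n) (hn1 : 1 < n) (hF : Fintype.card F = 7 ^ n) :
    IsDifferentiallyUniform 4
      (fun x : F => x ^ ((7 ^ n + 1) / 8 + (7 ^ n - 1) / 2)) := by
  have hS := isNonresidueSeven_of_card hn hF
  have hf := isQuarticRoot_pow hn hF
  apply le_antisymm
  · apply Finset.sup_le
    intro ab hab
    rw [differenceCount_pow_eq _ (Finset.mem_filter.mp hab).2]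
    exact differenceCount_le_four hS hf _
  · have hcard : 7 < Fintype.card F := by
      rw [hF]
      exact lt_self_pow₀ (by norm_num) hn1
    obtain ⟨x, hx, hx', hx0, hx1, hne⟩ := exists_consecutive_squares hS hcard
    obtain ⟨b, hb⟩ := four_le_differenceCount hS hf hx hx' hx0 hx1 hne
    refine hb.trans ?_
    exact Finset.le_sup (f := fun ab : F × F => differenceCount
      (fun x : F => x ^ ((7 ^ n + 1) / 8 + (7 ^ n - 1) / 2)) ab.1 ab.2) (b := (1, b)) (by simp)
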